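/- All graphs are finite and simple. For a connected graph $G$ with distance $d_G$ and diameter $\operatorname{diam}(G)$, a radio labeling is a map $f:V(G)\to\{0,1,2,\dots\}$ with $|f(u)-f(v)|\ge \operatorname{diam}(G)+1-d_G(u,v)$ for all distinct vertices $u,v$; the radio number $\mathrm{rn}(G)$ is the smallest $m$ such that $G$ has a radio labeling with maximum label $m$. For a tree $T$, the weight centers of $T$ are the vertices $v$ minimizing $\sum_{u\in V(T)}d_T(u,v)$, and $W(T)$ is the set of weight centers (a tree has one weight center or two adjacent ones). Put $L_T(u)=\min\{d_T(u,x):x\in W(T)\}$, $L(T)=\sum_{u\in V(T)}L_T(u)$, and $\varepsilon(T)=1$ if $T$ has only one weight center, $\varepsilon(T)=0$ if it has two. A tree $T$ of order $n$ and diameter $d$ is called a lower bound tree if $$\mathrm{rn}(T)=(n-1)(d+\varepsilon(T))-2L(T)+\varepsilon(T).$$ For $k\ge 1$ the $k$-double star $D_k$ is the tree obtained from two adjacent vertices $w_1,w_2$ by joining $k$ new leaves to each of $w_1$ and $w_2$. **Theorem.** Let $T$ be a lower bound tree of order $n_0$ and diameter $d_0$ with exactly one weight center $w_0$, and let $k\ge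 2$. Let $T_{D_k}$ be the graph obtained from $D_k$ by attaching a copy of $T$ at each leaf $x$ of $D_k$, the vertex $w_0$ of the copy being identified with $x$ (different leaves receiving disjoint copies), and let $d=\operatorname{diam}(T_{D_k})$. Then $W(T_{D_k})=\{w_1,w_2\}$, $T_{D_k}$ is a lower bound tree, and $$\mathrm{rn}(T_{D_k})=2k\bigl(\mathrm{rn}(T)+n_0(d-d_0-3)+d_0\bigr)+d.$$ -/

import Mathlib

namespace RadioTree

/-- `f` is a radio labeling of `G`: `|f u - f v| ≥ diam G + 1 - d(u, v)` for all distinct `u, v`. -/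
def IsRadioLabeling {V : Type*} (G : SimpleGraph V) (f : V → ℕ) : Prop :=
  ∀ u v : V, u ≠ v → (G.diam : ℤ) + 1 - (G.dist u v : ℤ) ≤ |(f u : ℤ) - (f v : ℤ)|

/-- The radio number `rn(G)`: the smallest `m` such that some radio labeling of `G` has
maximum label `m`. -/
noncomputable def radioNumber {V : Type*} (G : SimpleGraph V) : ℕ :=
  sInf {m : ℕ | ∃ f : V → ℕ, IsRadioLabeling G f ∧ IsGreatest (Set.range f) m}

/-- The weight of `G` from the vertex `v`: the sum of the distances from all vertices to `v`. -/
noncomputable def weightFrom {V : Type*} [Fintype V] (G : SimpleGraph V) (v : V) : ℕ :=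
  ∑ u, G.dist u v

/-- The set `W(G)` of weight centers: the vertices from which the weight is minimal. -/
def weightCenters {V : Type*} [Fintype V] (G : SimpleGraph V) : Set V :=
  {v | ∀ u, weightFrom G v ≤ weightFrom G u}

/-- The level of `u`: the distance from `u` to a nearest weight center. -/
noncomputable def level {V : Type*} [Fintype V] (G : SimpleGraph V) (u : V) : ℕ :=
  sInf ((fun x => G.dist u x) '' weightCenters G)

/-- The total level `L(G)`. -/
noncomputable def totalLevel {V : Type*} [Fintype V] (G : SimpleGraph V) : ℕ :=
  ∑ u, level G u

open Classical in
/-- `ε(G)` is `1` if there is only one weight center and `0` otherwise (a tree then has two,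
adjacent, weight centers). -/
noncomputable def epsilon {V : Type*} [Fintype V] (G : SimpleGraph V) : ℕ :=
  if ∃ w, weightCenters G = {w} then 1 else 0

/-- The lower bound `lb(G) = (n - 1)(d + ε) - 2 L(G) + ε`, where `n` is the order and `d` the
diameter; an integer. -/
noncomputable def lb {V : Type*} [Fintype V] (G : SimpleGraph V) : ℤ :=
  ((Fintype.card V : ℤ) - 1) * ((G.diam : ℤ) + (epsilon G : ℤ)) - 2 * (totalLevel G : ℤ)
    + (epsilon G : ℤ)

/-- A lower bound tree: a tree whose radio number equals the lower bound. -/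
def IsLowerBoundTree {V : Type*} [Fintype V] (G : SimpleGraph V) : Prop :=
  G.IsTree ∧ (radioNumber G : ℤ) = lb G

/-- A leaf: a vertex with exactly one neighbour. -/
def IsLeaf {V : Type*} (G : SimpleGraph V) (x : V) : Prop :=
  ∃! y, G.Adj x y

/-- The vertices obtained from a graph `H` by attaching, at each leaf `x` of `H`, a copy of the
vertex set `V` with the point `w` of the copy identified with `x`. The pair `(x, w)` is the
vertex `x` of `H`; for a leaf `x`, the pair `(x, v)` is the vertex `v` of the copy at `x`. -/
def AttachVertex {V' V : Type*} (H : SimpleGraph V') (w : V) : Type _ :=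
  {p : V' × V // p.2 = w ∨ IsLeaf H p.1}

noncomputable instance attachVertexFintype {V' V : Type*} [Finite V'] [Finite V] (H : SimpleGraph V') (w : V) :
    Fintype (AttachVertex H w) :=
  @Fintype.ofFinite _ (inferInstanceAs (Finite {p : V' × V // p.2 = w ∨ IsLeaf H p.1}))

/-- The graph obtained from `H` by identifying the vertex `w` of a copy of `G` with each leaf
of `H`. -/
def attachAtLeaves {V' V : Type*} (H : SimpleGraph V') (G : SimpleGraph V) (w : V) :
    SimpleGraph (AttachVertex H w) where
  Adj p q := (p.1.1 = q.1.1 ∧ G.Adj p.1.2 q.1.2) ∨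
    (p.1.2 = w ∧ q.1.2 = w ∧ H.Adj p.1.1 q.1.1)
  symm := ⟨by
    rintro p q (⟨h₁, h₂⟩ | ⟨h₁, h₂, h₃⟩)
    · exact Or.inl ⟨h₁.symm, h₂.symm⟩
    · exact Or.inr ⟨h₂, h₁, h₃.symm⟩⟩
  loopless := ⟨by
    rintro p (⟨_, h⟩ | ⟨_, _, h⟩)
    · exact G.loopless.irrefl _ h
    · exact H.loopless.irrefl _ h⟩

/-- The `k`-double star: two adjacent vertices `inl false` and `inl true`, and `k` further
vertices `inr (b, i)` joined to each of them (`inr (b, i)` being joined to `inl b`). -/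
def doubleStar (k : ℕ) : SimpleGraph (Bool ⊕ Bool × Fin k) where
  Adj
    | .inl a, .inl b => a ≠ b
    | .inl a, .inr (b, _) => a = b
    | .inr (a, _), .inl b => a = b
    | .inr _, .inr _ => False
  symm := ⟨by
    rintro (a | ⟨a, i⟩) (b | ⟨b, j⟩) h
    · exact Ne.symm h
    · exact Eq.symm h
    · exact Eq.symm h
    · exact h⟩
  loopless := ⟨by
    rintro (a | ⟨a, i⟩) h
    · exact h rfl
    · exact h⟩

/-- The graph `T_{D_k}`: a copy of `T` attached by its vertex `w` at each leaf of the
`k`-double star. -/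
abbrev doubleStarTree {V : Type*} (k : ℕ) (T : SimpleGraph V) (w : V) :
    SimpleGraph (AttachVertex (doubleStar k) w) :=
  attachAtLeaves (doubleStar k) T w

/-- The two central vertices of the double star, as vertices of `T_{D_k}`. -/
def hub {V : Type*} (k : ℕ) (w : V) (b : Bool) : AttachVertex (doubleStar k) w :=
  ⟨(Sum.inl b, w), Or.inl rfl⟩

end RadioTree

/-!
Why the double star tree is again a lower bound tree.

Let `l v` be the distance from `v` to the weight center `w` of `T`, and `h` the maximum of `l`.
The distances in `T_{D_k}` are explicit: those of `T` inside one copy of `T`, and otherwise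
`l v + l v' + 2` or `l v + l v' + 3`, as the two copies hang on the same hub or on different ones.
Hence its diameter is `2 * h + 3` (`diam_doubleStarTree`) and the hubs are its weight centers
(`weightCenters_doubleStarTree`). The graph is acyclic since no vertex has two neighbours below
it in the distance to a hub (`isAcyclic_of_height`).

For the lower bound on the radio number, two vertices are at distance at most one more than the
sum of their levels; adding up the resulting gaps between the labels, in increasing order of the
labels, gives `lb` (`span_ge_of_dist_le`).

For the upper bound, take a radio labeling `f` of `T` with maximum label `lb T`. Visit one hub,
then for each vertex `v` of `T` in the order of `f` its `2 * k` copies, alternating between the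
two sides, and then the other hub. A step from one vertex to the next one changes sides, and
within the block of `v` it raises the label by its least possible value
`2 * h + 1 - 2 * l v ≥ 1`; a step to the next block raises it by the increment of `f` plus
`2 * h - diam T`. Two visits to the same copy are separated by at least `2 * k - 1 ≥ 3` steps
inside blocks, and this is what the radio condition asks beyond the one for `f` in `T`
(`starLabel_of_lt`). The first and the last vertex of `T` for `f` are distinct, so that their
distances to `w` add up to at least `1`, and the largest label is then at most `lb` of the double
star tree (`radioNumber_doubleStarTree`).
-/

namespace RadioTree

/-! ### Distances and acyclicity in general graphs -/

theorem le_dist_of_adj_le {α : Type*} {G : SimpleGraph α} (hG : G.Connected) (p : α)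
    (φ : α → ℕ) (h₀ : φ p = 0) (h : ∀ x y, G.Adj x y → φ y ≤ φ x + 1) (q : α) :
    φ q ≤ G.dist p q := by
  have key : ∀ {x y : α} (r : G.Walk x y), φ y ≤ φ x + r.length := by
    intro x y r
    induction r with
    | nil => simp
    | cons hadj r ih => have := h _ _ hadj; simp only [SimpleGraph.Walk.length_cons]; omega
  obtain ⟨r, hr⟩ := hG.exists_walk_length_eq_dist p q
  have := key r
  omega

/-- At a highest vertex of a cycle, the two neighbours along the cycle would both be lower. -/
theorem isAcyclic_of_height {α : Type*} {G : SimpleGraph α} (φ : α → ℕ)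
    (hne : ∀ x y, G.Adj x y → φ x ≠ φ y)
    (huniq : ∀ x y z, G.Adj x y → G.Adj x z → φ y < φ x → φ z < φ x → y = z) :
    G.IsAcyclic := by
  classical
  intro v c hc
  obtain ⟨m, hm, hmax⟩ := c.support.toFinset.exists_max_image φ ⟨v, by simp⟩
  rw [List.mem_toFinset] at hm
  have hc' : (c.rotate m hm).IsCycle := hc.rotate hm
  have hle : ∀ x ∈ (c.rotate m hm).support, φ x ≤ φ m := fun x hx =>
    hmax x (by simpa [SimpleGraph.Walk.mem_support_rotate_iff] using hx)
  have h1 := SimpleGraph.Walk.adj_snd hc'.not_nil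
  have h2 := (SimpleGraph.Walk.adj_penultimate hc'.not_nil).symm
  have l1 := hle _ (SimpleGraph.Walk.getVert_mem_support _ 1)
  have l2 := hle _ (SimpleGraph.Walk.getVert_mem_support _ ((c.rotate m hm).length - 1))
  exact hc'.snd_ne_penultimate (huniq m _ _ h1 h2 (lt_of_le_of_ne l1 (hne _ _ h1).symm)
    (lt_of_le_of_ne l2 (hne _ _ h2).symm))

theorem closer_neighbor_unique {α : Type*} {G : SimpleGraph α} (hG : G.IsTree) {w x y z : α}
    (hy : G.Adj x y) (hz : G.Adj x z) (ly : G.dist y w < G.dist x w)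
    (lz : G.dist z w < G.dist x w) : y = z := by
  obtain ⟨p, hp⟩ := hG.connected.exists_walk_length_eq_dist y w
  obtain ⟨q, hq⟩ := hG.connected.exists_walk_length_eq_dist z w
  have hp' := (SimpleGraph.Walk.cons hy p).isPath_of_length_eq_dist (le_antisymm
    (by rw [SimpleGraph.Walk.length_cons]; omega) (SimpleGraph.dist_le _))
  have hq' := (SimpleGraph.Walk.cons hz q).isPath_of_length_eq_dist (le_antisymm
    (by rw [SimpleGraph.Walk.length_cons]; omega) (SimpleGraph.dist_le _))
  have := congrArg (fun r => r.1.snd) ((hG.isAcyclic.subsingleton_path _ _).elim ⟨_, hp'⟩ ⟨_, hq'⟩)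
  simpa using this

/-! ### The vertices and edges of the double star tree -/

theorem isLeaf_doubleStar_inr {k : ℕ} (c : Bool × Fin k) : IsLeaf (doubleStar k) (Sum.inr c) := by
  refine ⟨Sum.inl c.1, rfl, ?_⟩
  rintro (a | a) h
  · exact congrArg Sum.inl (Eq.symm h)
  · exact h.elim

theorem not_isLeaf_doubleStar_inl {k : ℕ} (hk : 1 ≤ k) (b : Bool) :
    ¬ IsLeaf (doubleStar k) (Sum.inl b) := by
  intro h
  have h1 : (doubleStar k).Adj (Sum.inl b) (Sum.inl (!b)) := by simp [doubleStar]
  have h2 : (doubleStar k).Adj (Sum.inl b) (Sum.inr (b, ⟨0, hk⟩)) := by simp [doubleStar]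
  exact absurd (h.unique h1 h2) (by simp)

/-- The vertex `v` of the copy of `T` attached at the leaf `inr c` of the double star. -/
def inCopy {V : Type*} {k : ℕ} (w : V) (c : Bool × Fin k) (v : V) :
    AttachVertex (doubleStar k) w :=
  ⟨(Sum.inr c, v), Or.inr (isLeaf_doubleStar_inr c)⟩

section

variable {V : Type*} {k : ℕ} {T : SimpleGraph V} {w : V}

theorem vertex_cases (hk : 1 ≤ k) {P : AttachVertex (doubleStar k) w → Prop}
    (h1 : ∀ b, P (hub k w b)) (h2 : ∀ c v, P (inCopy w c v)) (p) : P p := by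
  obtain ⟨⟨b | c, v⟩, hp⟩ := p
  · obtain rfl : v = w := hp.resolve_right (not_isLeaf_doubleStar_inl hk b)
    exact h1 b
  · exact h2 c v

theorem inCopy_inj {c c' : Bool × Fin k} {v v' : V} :
    inCopy w c v = inCopy w c' v' ↔ c = c' ∧ v = v' := by
  exact Subtype.ext_iff.trans (by simp [inCopy])

theorem hub_inj {b b' : Bool} : hub k w b = hub k w b' ↔ b = b' := by
  exact Subtype.ext_iff.trans (by simp [hub])

theorem hub_ne_inCopy {b : Bool} {c : Bool × Fin k} {v : V} : hub k w b ≠ inCopy w c v := by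
  exact Subtype.ext_iff.not.2 (by simp [hub, inCopy])

theorem adj_inCopy_inCopy {c c' : Bool × Fin k} {v v' : V} :
    (doubleStarTree k T w).Adj (inCopy w c v) (inCopy w c' v') ↔ c = c' ∧ T.Adj v v' := by
  simp [inCopy, attachAtLeaves, doubleStar]

theorem adj_hub_inCopy {b : Bool} {c : Bool × Fin k} {v : V} :
    (doubleStarTree k T w).Adj (hub k w b) (inCopy w c v) ↔ v = w ∧ b = c.1 := by
  simp [inCopy, hub, attachAtLeaves, doubleStar]

theorem adj_inCopy_hub {b : Bool} {c : Bool × Fin k} {v : V} :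
    (doubleStarTree k T w).Adj (inCopy w c v) (hub k w b) ↔ v = w ∧ b = c.1 := by
  rw [SimpleGraph.adj_comm, adj_hub_inCopy]

theorem adj_hub_hub {b b' : Bool} :
    (doubleStarTree k T w).Adj (hub k w b) (hub k w b') ↔ b ≠ b' := by
  simp [hub, attachAtLeaves, doubleStar]

theorem sum_vertices [Fintype V] (hk : 1 ≤ k) (F : AttachVertex (doubleStar k) w → ℕ) :
    ∑ p, F p = F (hub k w false) + F (hub k w true) + ∑ c, ∑ v, F (inCopy w c v) := by
  let g : Bool ⊕ (Bool × Fin k) × V → AttachVertex (doubleStar k) w :=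
    Sum.elim (hub k w) (fun x => inCopy w x.1 x.2)
  have hg : g.Bijective := by
    constructor
    · rintro (b | ⟨c, v⟩) (b' | ⟨c', v'⟩) h
      · rw [hub_inj.1 h]
      · exact absurd h hub_ne_inCopy
      · exact absurd h.symm hub_ne_inCopy
      · obtain ⟨rfl, rfl⟩ := inCopy_inj.1 h
        rfl
    · exact vertex_cases hk (fun b => ⟨Sum.inl b, rfl⟩) (fun c v => ⟨Sum.inr (c, v), rfl⟩)
  rw [← hg.sum_comp, Fintype.sum_sum_type, Fintype.sum_prod_type, Fintype.sum_bool, add_comm (F _)]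
  rfl

/-! ### The double star tree is a tree -/

theorem connected_doubleStarTree (hk : 1 ≤ k) (hT : T.Connected) :
    (doubleStarTree k T w).Connected := by
  have hub_reach : ∀ b, (doubleStarTree k T w).Reachable (hub k w false) (hub k w b) := by
    rintro (_ | _)
    · rfl
    · exact (adj_hub_hub.2 (by simp)).reachable
  have : ∀ p, (doubleStarTree k T w).Reachable (hub k w false) p := by
    refine vertex_cases hk hub_reach fun c v => ?_
    refine ((hub_reach c.1).trans (adj_hub_inCopy.2 ⟨rfl, rfl⟩).reachable).trans ?_
    exact (hT w v).map ⟨inCopy w c, fun h => adj_inCopy_inCopy.2 ⟨rfl, h⟩⟩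
  exact (SimpleGraph.connected_iff_exists_forall_reachable _).2 ⟨_, this⟩

/-- The distance to the hub on the side `false`. -/
noncomputable def height (T : SimpleGraph V) (p : AttachVertex (doubleStar k) w) : ℕ :=
  match p.1 with
  | (Sum.inl b, _) => b.toNat
  | (Sum.inr c, v) => T.dist v w + 1 + c.1.toNat

theorem isTree_doubleStarTree (hk : 1 ≤ k) (hT : T.IsTree) : (doubleStarTree k T w).IsTree := by
  have h1 : ∀ b, height T (hub k w b) = b.toNat := fun _ => rfl
  have h2 : ∀ c v, height (k := k) T (inCopy w c v) = T.dist v w + 1 + c.1.toNat :=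
    fun _ _ => rfl
  refine ⟨connected_doubleStarTree hk hT.connected, isAcyclic_of_height (height T) ?_ ?_⟩
  · refine vertex_cases hk (fun b => vertex_cases hk ?_ ?_)
      (fun c v => vertex_cases hk ?_ ?_)
    · intro b' h
      have := adj_hub_hub.1 h
      rw [h1, h1]
      revert this; cases b <;> cases b' <;> simp
    · intro c v h
      obtain ⟨rfl, rfl⟩ := adj_hub_inCopy.1 h
      rw [h1, h2]; omega
    · intro b h
      obtain ⟨rfl, rfl⟩ := adj_inCopy_hub.1 h
      rw [h1, h2]; omega
    · intro c' v' h
      obtain ⟨rfl, ha⟩ := adj_inCopy_inCopy.1 h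
      have := hT.dist_ne_of_adj w ha
      rw [SimpleGraph.dist_comm, SimpleGraph.dist_comm (u := w)] at this
      rw [h2, h2]; omega
  · refine vertex_cases hk (fun b => vertex_cases hk (fun b' => vertex_cases hk ?_ ?_)
      (fun c' v' => fun z _ hz => ?_)) (fun c v => vertex_cases hk
      (fun b' => vertex_cases hk ?_ ?_) (fun c' v' => vertex_cases hk ?_ ?_))
    · intro b'' h h'
      have g := adj_hub_hub.1 h
      have g' := adj_hub_hub.1 h'
      intros
      rw [hub_inj, Bool.eq_not_of_ne g.symm, Bool.eq_not_of_ne g'.symm]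
    · intro c v h h'
      obtain ⟨rfl, rfl⟩ := adj_hub_inCopy.1 h'
      simp only [h1, h2]; omega
    · rename_i h
      obtain ⟨rfl, rfl⟩ := adj_hub_inCopy.1 h
      rw [h1, h2]; omega
    · intro b'' h h' _ _
      rw [(adj_inCopy_hub.1 h).2, (adj_inCopy_hub.1 h').2]
    · intro c' v' h h'
      obtain ⟨rfl, rfl⟩ := adj_inCopy_hub.1 h
      obtain ⟨rfl, h'⟩ := adj_inCopy_inCopy.1 h'
      rw [h2, h2, SimpleGraph.dist_self]; omega
    · intro b' h h'
      obtain ⟨rfl, rfl⟩ := adj_inCopy_hub.1 h'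
      obtain ⟨rfl, h⟩ := adj_inCopy_inCopy.1 h
      rw [h2, h2, SimpleGraph.dist_self]; omega
    · intro c'' v'' h h'
      obtain ⟨rfl, ha⟩ := adj_inCopy_inCopy.1 h
      obtain ⟨rfl, ha'⟩ := adj_inCopy_inCopy.1 h'
      rw [h2, h2, h2]
      intro l l'
      rw [closer_neighbor_unique (w := w) hT ha ha' (by omega) (by omega)]

/-! ### Distances in the double star tree -/

open Classical in
/-- The distance in the double star tree, written out: it is the distance of `T` inside one copy
of `T`, and the length of the route through the hubs otherwise. -/
noncomputable def explicitDist (T : SimpleGraph V) (p q : AttachVertex (doubleStar k) w) : ℕ :=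
  match p.1, q.1 with
  | (Sum.inl b, _), (Sum.inl b', _) => if b = b' then 0 else 1
  | (Sum.inl b, _), (Sum.inr c, v) => T.dist v w + 1 + if b = c.1 then 0 else 1
  | (Sum.inr c, v), (Sum.inl b, _) => T.dist v w + 1 + if b = c.1 then 0 else 1
  | (Sum.inr c, v), (Sum.inr c', v') =>
    if c = c' then T.dist v v' else T.dist v w + T.dist v' w + if c.1 = c'.1 then 2 else 3

theorem explicitDist_le_dist (hk : 1 ≤ k) (hT : T.Connected)
    (p q : AttachVertex (doubleStar k) w) :
    explicitDist T p q ≤ (doubleStarTree k T w).dist p q := by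
  have e1 : ∀ b b', explicitDist T (hub k w b) (hub k w b') = if b = b' then 0 else 1 :=
    fun _ _ => by simp [explicitDist, hub]
  have e2 : ∀ b c v, explicitDist (k := k) T (hub k w b) (inCopy w c v) =
    T.dist v w + 1 + if b = c.1 then 0 else 1 := fun _ _ _ => by simp [explicitDist, hub, inCopy]
  have e3 : ∀ b c v, explicitDist (k := k) T (inCopy w c v) (hub k w b) =
    T.dist v w + 1 + if b = c.1 then 0 else 1 := fun _ _ _ => by simp [explicitDist, hub, inCopy]
  have e4 : ∀ c v c' v', explicitDist (k := k) T (inCopy w c v) (inCopy w c' v') =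
      if c = c' then T.dist v v' else T.dist v w + T.dist v' w + if c.1 = c'.1 then 2 else 3 :=
    fun _ _ _ _ => by simp [explicitDist, inCopy]
  have lip : ∀ u x y, T.Adj x y → T.dist x u ≤ T.dist y u + 1 := fun u x y h => by
    have := hT.dist_triangle (u := x) (v := y) (w := u)
    rw [SimpleGraph.dist_eq_one_iff_adj.2 h] at this
    omega
  have lip' : ∀ u x y, T.Adj x y → T.dist u x ≤ T.dist u y + 1 := fun u x y h => by
    rw [T.dist_comm, T.dist_comm (u := u)]; exact lip u x y h
  refine le_dist_of_adj_le (connected_doubleStarTree hk hT) p _ ?_ ?_ q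
  · revert p
    refine vertex_cases hk (fun b => ?_) (fun c v => ?_)
    · simp [e1]
    · simp [e4]
  · revert p
    refine vertex_cases hk (fun b => ?_) (fun c v => ?_)
    · refine vertex_cases hk (fun b' => vertex_cases hk (fun b'' h => ?_) (fun c'' v'' h => ?_))
        (fun c' v' => vertex_cases hk (fun b'' h => ?_) (fun c'' v'' h => ?_))
      · simp only [e1]; split_ifs <;> omega
      · obtain ⟨rfl, rfl⟩ := adj_hub_inCopy.1 h
        simp only [e1, e2, SimpleGraph.dist_self]; split_ifs <;> omega
      · obtain ⟨rfl, rfl⟩ := adj_inCopy_hub.1 h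
        simp only [e1, e2, SimpleGraph.dist_self]; split_ifs <;> omega
      · obtain ⟨rfl, ha⟩ := adj_inCopy_inCopy.1 h
        have := lip w _ _ ha.symm
        simp only [e2]; split_ifs <;> omega
    · refine vertex_cases hk (fun b' => vertex_cases hk (fun b'' h => ?_) (fun c'' v'' h => ?_))
        (fun c' v' => vertex_cases hk (fun b'' h => ?_) (fun c'' v'' h => ?_))
      · simp only [e3]; split_ifs <;> omega
      · obtain ⟨rfl, rfl⟩ := adj_hub_inCopy.1 h
        simp only [e3, e4, SimpleGraph.dist_self]; grind
      · obtain ⟨rfl, rfl⟩ := adj_inCopy_hub.1 h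
        simp only [e3, e4, SimpleGraph.dist_self]; grind
      · obtain ⟨rfl, ha⟩ := adj_inCopy_inCopy.1 h
        have := lip w _ _ ha.symm
        have := lip' v _ _ ha.symm
        simp only [e4]; split_ifs <;> omega

theorem dist_inCopy_le (hT : T.Connected) (c : Bool × Fin k) (v v' : V) :
    (doubleStarTree k T w).dist (inCopy w c v) (inCopy w c v') ≤ T.dist v v' := by
  obtain ⟨r, hr⟩ := hT.exists_walk_length_eq_dist v v'
  rw [← hr, ← SimpleGraph.Walk.length_map
    (⟨inCopy w c, fun h => adj_inCopy_inCopy.2 ⟨rfl, h⟩⟩ : T →g doubleStarTree k T w)]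
  exact SimpleGraph.dist_le _

theorem dist_hub_hub (b b' : Bool) :
    (doubleStarTree k T w).dist (hub k w b) (hub k w b') = if b = b' then 0 else 1 := by
  split_ifs with h
  · rw [h, SimpleGraph.dist_self]
  · exact SimpleGraph.dist_eq_one_iff_adj.2 (adj_hub_hub.2 h)

theorem dist_inCopy_hub (hk : 1 ≤ k) (hT : T.Connected) (c : Bool × Fin k) (v : V) (b : Bool) :
    (doubleStarTree k T w).dist (inCopy w c v) (hub k w b) =
      T.dist v w + 1 + if b = c.1 then 0 else 1 := by
  have h0 := explicitDist_le_dist hk hT (inCopy w c v) (hub k w b)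
  refine le_antisymm ?_ h0
  have hc := connected_doubleStarTree (w := w) hk hT
  have h1 := hc.dist_triangle (u := inCopy w c v) (v := inCopy w c w) (w := hub k w b)
  have h2 := hc.dist_triangle (u := inCopy w c w) (v := hub k w c.1) (w := hub k w b)
  have h3 := dist_inCopy_le (w := w) hT c v w
  rw [SimpleGraph.dist_eq_one_iff_adj.2 (adj_inCopy_hub.2 ⟨rfl, rfl⟩), dist_hub_hub] at h2
  grind

theorem dist_hub_inCopy (hk : 1 ≤ k) (hT : T.Connected) (c : Bool × Fin k) (v : V) (b : Bool) :
    (doubleStarTree k T w).dist (hub k w b) (inCopy w c v) =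
      T.dist v w + 1 + if b = c.1 then 0 else 1 := by
  rw [SimpleGraph.dist_comm, dist_inCopy_hub hk hT]

theorem dist_inCopy_inCopy_self (hk : 1 ≤ k) (hT : T.Connected) (c : Bool × Fin k) (v v' : V) :
    (doubleStarTree k T w).dist (inCopy w c v) (inCopy w c v') = T.dist v v' := by
  have h0 := explicitDist_le_dist hk hT (inCopy w c v) (inCopy w c v')
  exact le_antisymm (dist_inCopy_le hT c v v') ((if_pos rfl).symm.trans_le h0)

theorem dist_inCopy_inCopy_of_ne (hk : 1 ≤ k) (hT : T.Connected) {c c' : Bool × Fin k}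
    (hcc : c ≠ c') (v v' : V) :
    (doubleStarTree k T w).dist (inCopy w c v) (inCopy w c' v') =
      T.dist v w + T.dist v' w + if c.1 = c'.1 then 2 else 3 := by
  have h0 := explicitDist_le_dist hk hT (inCopy w c v) (inCopy w c' v')
  refine le_antisymm ?_ ((?_ : _ = explicitDist T (inCopy w c v) (inCopy w c' v')).trans_le h0)
  swap
  · simp [explicitDist, inCopy, hcc]
  have hc := connected_doubleStarTree (w := w) hk hT
  have h1 := hc.dist_triangle (u := inCopy w c v) (v := hub k w c.1) (w := inCopy w c' v')
  rw [dist_inCopy_hub hk hT, dist_hub_inCopy hk hT] at h1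
  grind

theorem diam_doubleStarTree [Finite V] (hk : 1 ≤ k) (hT : T.Connected) {h : ℕ}
    (hle : ∀ v, T.dist v w ≤ h) (hex : ∃ v, T.dist v w = h) :
    (doubleStarTree k T w).diam = 2 * h + 3 := by
  have hc := connected_doubleStarTree (w := w) hk hT
  have : Nonempty (AttachVertex (doubleStar k) w) := hc.nonempty
  have hfin : Finite (AttachVertex (doubleStar k) w) := Finite.of_fintype _
  obtain ⟨v, hv⟩ := hex
  apply le_antisymm
  · obtain ⟨p, q, hpq⟩ := (doubleStarTree k T w).exists_dist_eq_diam
    rw [← hpq]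
    have hub_le : ∀ p b, (doubleStarTree k T w).dist p (hub k w b) ≤ h + 2 := by
      refine vertex_cases hk (fun b b' => ?_) (fun c v b => ?_)
      · rw [dist_hub_hub]; grind
      · have := hle v
        rw [dist_inCopy_hub hk hT]; grind
    clear hpq
    revert p q
    refine vertex_cases hk (fun b q => ?_) (fun c v => vertex_cases hk (fun b => ?_)
      (fun c' v' => ?_))
    · have := hub_le q b
      rw [SimpleGraph.dist_comm]; omega
    · have := hub_le (inCopy w c v) b
      omega
    · have l1 := hle v
      have l2 := hle v'
      by_cases hcc : c = c'
      · rw [hcc, dist_inCopy_inCopy_self hk hT]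
        have := hT.dist_triangle (u := v) (v := w) (w := v')
        rw [T.dist_comm (u := w)] at this
        omega
      · rw [dist_inCopy_inCopy_of_ne hk hT hcc]; grind
  · have := SimpleGraph.dist_le_diam (SimpleGraph.connected_iff_ediam_ne_top.1 hc)
      (u := inCopy w (false, ⟨0, hk⟩) v) (v := inCopy w (true, ⟨0, hk⟩) v)
    rw [dist_inCopy_inCopy_of_ne hk hT (by simp)] at this
    simp at this
    omega

end

/-! ### The lower bound for the span of a radio labeling -/

/-- In order of increasing labels, consecutive vertices `u`, `v` have labels at least
`D - l u - l v` apart. In the sum of these gaps every vertex is counted twice except the first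
one, `a`, and the last one, `b`. -/
theorem exists_span_ge {α : Type*} (f l : α → ℕ) (D : ℤ) (s : Finset α)
    (hs : s.Nonempty)
    (hf : ∀ u v, u ≠ v → f u ≤ f v → D - l u - l v ≤ (f v : ℤ) - f u) :
    ∃ a ∈ s, ∃ b ∈ s,
      ((s.card : ℤ) - 1) * D - 2 * ∑ x ∈ s, (l x : ℤ) + l a + l b ≤ (f b : ℤ) - f a := by
  classical
  induction s using Finset.induction_on_max_value f with
  | empty => simp at hs
  | insert m s hm hmax ih =>
    rcases s.eq_empty_or_nonempty with rfl | hne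
    · exact ⟨m, by simp, m, by simp, by simp; linarith⟩
    · obtain ⟨a, ha, b, hb, hab⟩ := ih hne
      refine ⟨a, by simp [ha], m, by simp, ?_⟩
      have := hf b m (fun h => hm (h ▸ hb)) (hmax b hb)
      rw [Finset.card_insert_of_notMem hm, Finset.sum_insert hm]
      push_cast
      linarith

theorem span_ge_of_dist_le {α : Type*} [Fintype α] [Nonempty α] {G : SimpleGraph α} {l : α → ℕ}
    (hl : ∀ u v, G.dist u v ≤ l u + l v + 1) {f : α → ℕ} (hf : IsRadioLabeling G f) {m : ℕ}
    (hm : IsGreatest (Set.range f) m) :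
    ((Fintype.card α : ℤ) - 1) * G.diam - 2 * ∑ x, (l x : ℤ) ≤ m := by
  obtain ⟨a, -, b, -, h⟩ := exists_span_ge f l G.diam Finset.univ Finset.univ_nonempty
    (fun u v huv hle => by
      have h1 := hf u v huv
      have h2 := hl u v
      have h3 : |(f u : ℤ) - f v| = f v - f u := by rw [abs_sub_comm, abs_of_nonneg]; omega
      omega)
  have := hm.2 ⟨b, rfl⟩
  rw [Finset.card_univ] at h
  omega

/-! ### Weight centers and levels of the double star tree -/

section

variable {V : Type*} [Fintype V] {k : ℕ} {T : SimpleGraph V} {w : V}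

theorem card_attachVertex_doubleStar (hk : 1 ≤ k) :
    Fintype.card (AttachVertex (doubleStar k) w) = 2 * k * Fintype.card V + 2 := by
  rw [Fintype.card_eq_sum_ones, sum_vertices hk]
  simp
  ring

theorem weightFrom_hub (hk : 1 ≤ k) (hT : T.Connected) (b : Bool) :
    weightFrom (doubleStarTree k T w) (hub k w b) =
      1 + ∑ c : Bool × Fin k, ∑ v, (T.dist v w + 1 + if b = c.1 then 0 else 1) := by
  rw [weightFrom, sum_vertices hk]
  simp only [dist_hub_hub, dist_inCopy_hub hk hT]
  cases b <;> simp

theorem weightFrom_hub_eq (hk : 1 ≤ k) (hT : T.Connected) (b b' : Bool) :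
    weightFrom (doubleStarTree k T w) (hub k w b) =
      weightFrom (doubleStarTree k T w) (hub k w b') := by
  rw [weightFrom_hub hk hT, weightFrom_hub hk hT]
  cases b <;> cases b' <;> simp [Fintype.sum_prod_type, Finset.sum_add_distrib]

/-- Moving from a hub into a copy of `T` increases the distance to every other copy, and
decreases it by no more than the same amount to the copy itself. -/
theorem weightFrom_hub_lt (hk : 1 ≤ k) (hT : T.Connected) (c : Bool × Fin k) (v : V) :
    weightFrom (doubleStarTree k T w) (hub k w c.1) <
      weightFrom (doubleStarTree k T w) (inCopy w c v) := by
  classical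
  have h1 : weightFrom (doubleStarTree k T w) (inCopy w c v) =
      2 * T.dist v w + 3 + ∑ c', ∑ v', (doubleStarTree k T w).dist (inCopy w c' v') (inCopy w c v) := by
    rw [weightFrom, sum_vertices hk]
    simp only [dist_hub_inCopy hk hT]
    obtain ⟨b | b, i⟩ := c <;> simp <;> ring
  rw [weightFrom_hub hk hT, h1]
  have h2 : ∀ c' : Bool × Fin k,
      ∑ v', ((T.dist v' w : ℤ) + 1 + if c.1 = c'.1 then 0 else 1) +
        (T.dist v w + 1) * Fintype.card V * (1 - if c = c' then 2 else 0) ≤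
      ∑ v', ((doubleStarTree k T w).dist (inCopy w c' v') (inCopy w c v) : ℤ) := by
    intro c'
    have : ((T.dist v w : ℤ) + 1) * Fintype.card V * (1 - if c = c' then 2 else 0) =
        ∑ _v' : V, ((T.dist v w : ℤ) + 1) * (1 - if c = c' then 2 else 0) := by
      rw [Finset.sum_const, Finset.card_univ, nsmul_eq_mul]
      ring
    rw [this, ← Finset.sum_add_distrib]
    refine Finset.sum_le_sum fun v' _ => ?_
    by_cases hcc : c = c'
    · subst hcc
      have := hT.dist_triangle (u := v') (v := v) (w := w)
      simp only [dist_inCopy_inCopy_self hk hT, if_true]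
      omega
    · rw [dist_inCopy_inCopy_of_ne hk hT (Ne.symm hcc), if_neg hcc]
      push_cast
      split_ifs <;> first | omega | grind
  have h3 := Finset.sum_le_sum (fun c' (_ : c' ∈ Finset.univ) => h2 c')
  rw [Finset.sum_add_distrib, ← Finset.mul_sum, Finset.sum_sub_distrib, Finset.sum_ite_eq] at h3
  simp only [Finset.mem_univ, if_true, Finset.sum_const, Finset.card_univ, Fintype.card_prod,
    Fintype.card_bool, Fintype.card_fin, nsmul_eq_mul] at h3
  have h4 : (0 : ℤ) ≤ (T.dist v w + 1) * Fintype.card V * (((2 * k : ℕ) : ℤ) * 1 - 2) :=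
    mul_nonneg (by positivity) (by push_cast; omega)
  zify
  push_cast at h3 h4 ⊢
  linarith

theorem weightCenters_doubleStarTree (hk : 1 ≤ k) (hT : T.Connected) :
    weightCenters (doubleStarTree k T w) = {hub k w false, hub k w true} := by
  ext p
  simp only [weightCenters, Set.mem_ofPred_eq, Set.mem_insert_iff, Set.mem_singleton_iff]
  constructor
  · revert p
    refine vertex_cases hk (fun b _ => ?_) (fun c v h => ?_)
    · cases b <;> simp
    · exact absurd (h (hub k w c.1)) (weightFrom_hub_lt hk hT c v).not_ge
  · have : ∀ b u, weightFrom (doubleStarTree k T w) (hub k w b) ≤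
        weightFrom (doubleStarTree k T w) u := fun b => vertex_cases hk
      (fun b' => (weightFrom_hub_eq hk hT b b').le)
      (fun c v => (weightFrom_hub_eq hk hT b c.1).trans_le (weightFrom_hub_lt hk hT c v).le)
    rintro (rfl | rfl) <;> exact this _

theorem level_doubleStarTree (hk : 1 ≤ k) (hT : T.Connected)
    (p : AttachVertex (doubleStar k) w) :
    level (doubleStarTree k T w) p = min ((doubleStarTree k T w).dist p (hub k w false))
      ((doubleStarTree k T w).dist p (hub k w true)) := by
  rw [level, weightCenters_doubleStarTree hk hT, Set.image_pair, csInf_pair]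

theorem level_hub (hk : 1 ≤ k) (hT : T.Connected) (b : Bool) :
    level (doubleStarTree k T w) (hub k w b) = 0 := by
  rw [level_doubleStarTree hk hT, dist_hub_hub, dist_hub_hub]
  cases b <;> simp

theorem level_inCopy (hk : 1 ≤ k) (hT : T.Connected) (c : Bool × Fin k) (v : V) :
    level (doubleStarTree k T w) (inCopy w c v) = T.dist v w + 1 := by
  rw [level_doubleStarTree hk hT, dist_inCopy_hub hk hT, dist_inCopy_hub hk hT]
  obtain ⟨_ | _, i⟩ := c <;> simp

theorem dist_le_level_add_level (hk : 1 ≤ k) (hT : T.Connected) :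
    ∀ p q : AttachVertex (doubleStar k) w, (doubleStarTree k T w).dist p q ≤
      level (doubleStarTree k T w) p + level (doubleStarTree k T w) q + 1 := by
  refine vertex_cases hk (fun b => vertex_cases hk (fun b' => ?_) (fun c' v' => ?_))
    (fun c v => vertex_cases hk (fun b' => ?_) (fun c' v' => ?_))
  · rw [dist_hub_hub]; split_ifs <;> omega
  · rw [dist_hub_inCopy hk hT, level_inCopy hk hT]; split_ifs <;> omega
  · rw [dist_inCopy_hub hk hT, level_inCopy hk hT]; split_ifs <;> omega
  · rw [level_inCopy hk hT, level_inCopy hk hT]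
    by_cases hcc : c = c'
    · rw [hcc, dist_inCopy_inCopy_self hk hT]
      have := hT.dist_triangle (u := v) (v := w) (w := v')
      rw [T.dist_comm (u := w)] at this
      omega
    · rw [dist_inCopy_inCopy_of_ne hk hT hcc]; split_ifs <;> omega

theorem epsilon_doubleStarTree (hk : 1 ≤ k) (hT : T.Connected) :
    epsilon (doubleStarTree k T w) = 0 := by
  rw [epsilon, if_neg]
  rintro ⟨x, hx⟩
  rw [weightCenters_doubleStarTree hk hT] at hx
  have h1 : hub k w false = x := hx.subset (by simp)
  have h2 : hub k w true = x := hx.subset (by simp)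
  exact absurd (hub_inj.1 (h1.trans h2.symm)) (by simp)

theorem lb_doubleStarTree (hk : 1 ≤ k) (hT : T.Connected) :
    lb (doubleStarTree k T w) = (2 * k * Fintype.card V + 1) * (doubleStarTree k T w).diam -
      2 * (2 * k * (∑ v, (T.dist v w : ℤ) + Fintype.card V)) := by
  have h : totalLevel (doubleStarTree k T w) =
      2 * k * (∑ v, T.dist v w + Fintype.card V) := by
    rw [totalLevel, sum_vertices hk]
    simp [level_hub hk hT, level_inCopy hk hT, Finset.sum_add_distrib]
  rw [lb, epsilon_doubleStarTree hk hT, h, card_attachVertex_doubleStar hk]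
  push_cast
  ring

theorem lb_of_weightCenters_eq_singleton (hw : weightCenters T = {w}) :
    lb T = ((Fintype.card V : ℤ) - 1) * (T.diam + 1) - 2 * ∑ v, (T.dist v w : ℤ) + 1 := by
  have h1 : epsilon T = 1 := by rw [epsilon, if_pos ⟨w, hw⟩]
  have h2 : totalLevel T = ∑ v, T.dist v w := by simp [totalLevel, level, hw]
  rw [lb, h1, h2]
  push_cast
  rfl

end

/-! ### The labeling of the double star tree -/

theorem exists_isRadioLabeling {α : Type*} [Finite α] [Nonempty α] (G : SimpleGraph α) :
    {m : ℕ | ∃ f : α → ℕ, IsRadioLabeling G f ∧ IsGreatest (Set.range f) m}.Nonempty := by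
  obtain ⟨n, ⟨e⟩⟩ := Finite.exists_equiv_fin α
  let f : α → ℕ := fun x => (e x : ℕ) * (G.diam + 1)
  obtain ⟨b, hb⟩ := Finite.exists_max f
  refine ⟨f b, f, fun u v huv => ?_, ⟨b, rfl⟩, by rintro _ ⟨x, rfl⟩; exact hb x⟩
  have h1 : ((e u : ℕ) : ℤ) - (e v : ℕ) ≠ 0 := by
    rw [sub_ne_zero]
    exact_mod_cast fun h => huv (e.injective (Fin.ext h))
  have h2 : (f u : ℤ) - f v = ((e u : ℕ) - (e v : ℕ)) * ((G.diam : ℤ) + 1) := by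
    simp only [f]; push_cast; ring
  rw [h2, abs_mul, abs_of_nonneg (by positivity : (0 : ℤ) ≤ (G.diam : ℤ) + 1)]
  have h3 := Int.one_le_abs h1
  nlinarith

theorem IsRadioLabeling.le_of_lt {α : Type*} {G : SimpleGraph α} {f : α → ℕ}
    (hf : IsRadioLabeling G f) {u v : α} (h : f u < f v) :
    f u + G.diam + 1 ≤ f v + G.dist u v := by
  have h1 := hf u v (by rintro rfl; exact h.false)
  rw [abs_sub_comm, abs_of_nonneg (by omega)] at h1
  omega

theorem IsRadioLabeling.injective {α : Type*} {G : SimpleGraph α} {f : α → ℕ}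
    (hf : IsRadioLabeling G f) (hG : G.ediam ≠ ⊤) : f.Injective := by
  intro u v huv
  by_contra hne
  have h1 := hf u v hne
  have h2 := SimpleGraph.dist_le_diam hG (u := u) (v := v)
  rw [huv, sub_self, abs_zero] at h1
  omega

section

variable {V : Type*} {k : ℕ} {T : SimpleGraph V} {w : V}

/-- The rank of a copy of `T` in the order used by the labeling, which alternates between the two
sides of the double star. -/
def copyRank (c : Bool × Fin k) : ℕ := 2 * c.2 + c.1.toNat

theorem copyRank_lt (c : Bool × Fin k) : copyRank c < 2 * k := by
  obtain ⟨_ | _, i, hi⟩ := c <;> simp [copyRank] <;> omega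

theorem copyRank_false_lt (c : Bool × Fin k) (hc : c.1 = false) : copyRank c + 1 < 2 * k := by
  obtain ⟨_ | _, i, hi⟩ := c
  · simp [copyRank]; omega
  · simp at hc

theorem copyRank_mod_two (c : Bool × Fin k) : copyRank c % 2 = c.1.toNat := by
  obtain ⟨_ | _, i, hi⟩ := c <;> simp [copyRank]

theorem copyRank_injective : (copyRank (k := k)).Injective := by
  rintro ⟨_ | _, i⟩ ⟨_ | _, j⟩ h <;> simp [copyRank] at h ⊢ <;> omega

/-- The difference between the labels of the vertices `u` of two copies of `T` with consecutive
ranks. Here `h` is the largest distance from `w` in `T`, and `l u` is the distance from `u`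
to `w`. -/
def copyGap (h : ℕ) (l : V → ℕ) (u : V) : ℕ := 2 * h + 1 - 2 * l u

/-- Two copies of one vertex of `T`. -/
theorem starLabel_of_copyRank_lt (hk : 2 ≤ k) (hT : T.Connected) {h : ℕ}
    (hh : ∀ v, T.dist v w ≤ h) {c c' : Bool × Fin k} (hc : copyRank c < copyRank c') (v : V) :
    2 * h + 4 + copyRank c * copyGap h (T.dist · w) v ≤
      copyRank c' * copyGap h (T.dist · w) v +
        (doubleStarTree k T w).dist (inCopy w c v) (inCopy w c' v) := by
  have hv := hh v
  rw [dist_inCopy_inCopy_of_ne (by omega) hT (by rintro rfl; exact hc.false)]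
  have h1 : 2 * T.dist v w + copyGap h (T.dist · w) v = 2 * h + 1 := by
    simp only [copyGap]; omega
  split_ifs with hs
  · have e1 := copyRank_mod_two c
    have e2 := copyRank_mod_two c'
    rw [hs] at e1
    have h5 := Nat.mul_le_mul_right (copyGap h (T.dist · w) v)
      (show copyRank c + 2 ≤ copyRank c' by omega)
    rw [Nat.add_mul] at h5
    omega
  · have h5 := Nat.mul_le_mul_right (copyGap h (T.dist · w) v)
      (show copyRank c + 1 ≤ copyRank c' by omega)
    rw [Nat.succ_mul] at h5
    omega

variable [Fintype V]

/-- The label, up to an additive constant, of the vertex `v` of the copy of `T` of rank `0`, when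
`f` is a radio labeling of `T` and `T` has diameter `d`: the vertices `u` preceding `v` for `f`
contribute the gaps within their blocks, and the growth `2 * h - d` of the steps between
consecutive blocks. -/
def blockStart (k h d : ℕ) (f l : V → ℕ) (v : V) : ℕ :=
  f v + ∑ u with f u < f v, ((2 * k - 1) * copyGap h l u + (2 * h - d))

theorem blockStart_lt {h d : ℕ} {f l : V → ℕ} {v v' : V} (hv : f v < f v') :
    blockStart k h d f l v + f v' + (2 * k - 1) * copyGap h l v + (2 * h - d) ≤
      blockStart k h d f l v' + f v := by
  classical
  have h1 : insert v ({u | f u < f v} : Finset V) ⊆ ({u | f u < f v'} : Finset V) := by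
    intro u hu
    simp only [Finset.mem_insert, Finset.mem_filter, Finset.mem_univ, true_and] at hu ⊢
    rcases hu with rfl | hu
    · exact hv
    · exact hu.trans hv
  have h2 := Finset.sum_le_sum_of_subset (f := fun u =>
    (2 * k - 1) * copyGap h l u + (2 * h - d)) h1
  rw [Finset.sum_insert (by simp)] at h2
  simp only [blockStart]
  omega

/-- In the block of the last vertex `b`, all other vertices of `T` have been passed. -/
theorem blockStart_of_isMax {h d : ℕ} {f l : V → ℕ} (hf : f.Injective) {b : V}
    (hb : ∀ x, f x ≤ f b) :
    blockStart k h d f l b + (2 * k - 1) * copyGap h l b + (2 * h - d) =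
      f b + ((2 * k - 1) * ∑ u, copyGap h l u + Fintype.card V * (2 * h - d)) := by
  classical
  have h1 : ({u | f u < f b} : Finset V) = Finset.univ.erase b := by
    ext u
    simp only [Finset.mem_filter, Finset.mem_univ, true_and, Finset.mem_erase, and_true]
    exact ⟨fun h e => by simp [e] at h, fun h => lt_of_le_of_ne (hb u) (hf.ne h)⟩
  have h2 : ∑ u, ((2 * k - 1) * copyGap h l u + (2 * h - d)) =
      (2 * k - 1) * ∑ u, copyGap h l u + Fintype.card V * (2 * h - d) := by
    rw [Finset.sum_add_distrib, Finset.mul_sum, Finset.sum_const, Finset.card_univ, smul_eq_mul]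
  rw [← h2, ← Finset.sum_erase_add _ _ (Finset.mem_univ b), blockStart, h1]
  ring

/-- The label of the hub on the side `false`, which is visited last. -/
def lastLabel (k h d : ℕ) (f l : V → ℕ) (a b : V) : ℕ :=
  2 * h + 2 - l a + blockStart k h d f l b + (2 * k - 1) * copyGap h l b + (2 * h + 2 - l b)

/-- The labeling of the double star tree built from a labeling `f` of `T` with first vertex `a`
and last vertex `b`. It visits the hub on the side `true`, then, for each vertex of `T` in the
order of `f`, the block of its copies in the order of `copyRank`, and then the other hub. -/
def starLabel (k h d : ℕ) (w : V) (f l : V → ℕ) (a b : V)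
    (p : AttachVertex (doubleStar k) w) : ℕ :=
  match p.1 with
  | (Sum.inl true, _) => 0
  | (Sum.inl false, _) => lastLabel k h d f l a b
  | (Sum.inr c, v) => 2 * h + 2 - l a + blockStart k h d f l v + copyRank c * copyGap h l v

/-- Vertices in different blocks: the radio condition for `f` in `T` carries over. -/
theorem starLabel_of_lt (hk : 2 ≤ k) (hT : T.Connected) {h : ℕ} (hh : ∀ v, T.dist v w ≤ h)
    (hd : T.diam ≤ 2 * h) {f : V → ℕ} (hf : IsRadioLabeling T f) {v v' : V} (hv : f v < f v')
    (c c' : Bool × Fin k) :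
    2 * h + 4 + (blockStart k h T.diam f (T.dist · w) v + copyRank c * copyGap h (T.dist · w) v) ≤
      blockStart k h T.diam f (T.dist · w) v' + copyRank c' * copyGap h (T.dist · w) v' +
        (doubleStarTree k T w).dist (inCopy w c v) (inCopy w c' v') := by
  have hg : ∀ u, 1 ≤ copyGap h (T.dist · w) u := fun u => by
    have := hh u; simp only [copyGap]; omega
  have h1 := blockStart_lt (k := k) (h := h) (d := T.diam) (l := (T.dist · w)) hv
  have h2 := hf.le_of_lt hv
  have hr := copyRank_lt c
  by_cases hcc : c = c'
  · subst hcc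
    rw [dist_inCopy_inCopy_self (by omega) hT]
    -- The `2 * k - 1 ≥ 3` steps inside blocks make up for the three edges through the hubs.
    have h3 : 2 * k - 1 ≤ (2 * k - 1 - copyRank c) * copyGap h (T.dist · w) v +
        copyRank c * copyGap h (T.dist · w) v' := by
      have e1 := Nat.mul_le_mul_left (2 * k - 1 - copyRank c) (hg v)
      have e2 := Nat.mul_le_mul_left (copyRank c) (hg v')
      omega
    have h4 : (2 * k - 1) * copyGap h (T.dist · w) v =
        (2 * k - 1 - copyRank c) * copyGap h (T.dist · w) v +
          copyRank c * copyGap h (T.dist · w) v := by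
      rw [← Nat.add_mul]; congr 1; omega
    omega
  · rw [dist_inCopy_inCopy_of_ne (by omega) hT hcc]
    have h3 := hT.dist_triangle (u := v) (v := w) (w := v')
    rw [T.dist_comm (u := w)] at h3
    have h4 := Nat.mul_le_mul_right (copyGap h (T.dist · w) v) (show copyRank c ≤ 2 * k - 1 by omega)
    split_ifs with hs
    · -- On one side the two ranks have the same parity, which leaves one more step.
      rcases Nat.lt_or_ge (copyRank c) (2 * k - 1) with hlt | hge
      · have h5 := Nat.mul_le_mul_right (copyGap h (T.dist · w) v)
          (show copyRank c + 1 ≤ 2 * k - 1 by omega)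
        rw [Nat.succ_mul] at h5
        have := hg v
        omega
      · have e1 := copyRank_mod_two c
        have e2 := copyRank_mod_two c'
        rw [hs] at e1
        have h5 := Nat.mul_le_mul (show 1 ≤ copyRank c' by omega) (hg v')
        omega
    · omega

theorem starLabel_first (hk : 2 ≤ k) (hT : T.Connected) {h : ℕ} (hh : ∀ v, T.dist v w ≤ h)
    (hd : T.diam ≤ 2 * h) {f : V → ℕ} (hf : IsRadioLabeling T f) (hinj : f.Injective) {a : V}
    (ha : ∀ x, f a ≤ f x) (c : Bool × Fin k) (v : V) :
    2 * h + 4 ≤ 2 * h + 2 - T.dist a w + blockStart k h T.diam f (T.dist · w) v +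
      copyRank c * copyGap h (T.dist · w) v +
        (doubleStarTree k T w).dist (hub k w true) (inCopy w c v) := by
  rw [dist_hub_inCopy (by omega) hT]
  have hg : ∀ u, 1 ≤ copyGap h (T.dist · w) u := fun u => by
    have := hh u; simp only [copyGap]; omega
  have h0 := hh a
  have h0' := hh v
  rcases (ha v).eq_or_lt with he | hlt
  · obtain rfl := hinj he
    split_ifs with hs
    · have e1 := copyRank_mod_two c
      rw [← hs, Bool.toNat_true] at e1
      have h5 := Nat.mul_le_mul (show 1 ≤ copyRank c by omega) (hg a)
      omega
    · omega
  · have h1 := blockStart_lt (k := k) (h := h) (d := T.diam) (l := (T.dist · w)) hlt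
    have h2 := hf.le_of_lt hlt
    have h3 := hT.dist_triangle (u := a) (v := w) (w := v)
    rw [T.dist_comm (u := w)] at h3
    have h4 := Nat.mul_le_mul (show 1 ≤ 2 * k - 1 by omega) (hg a)
    omega

theorem starLabel_last (hk : 2 ≤ k) (hT : T.Connected) {h : ℕ} (hh : ∀ v, T.dist v w ≤ h)
    (hd : T.diam ≤ 2 * h) {f : V → ℕ} (hf : IsRadioLabeling T f) (hinj : f.Injective) (a : V)
    {b : V} (hb : ∀ x, f x ≤ f b) (c : Bool × Fin k) (v : V) :
    2 * h + 4 + (2 * h + 2 - T.dist a w + blockStart k h T.diam f (T.dist · w) v +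
      copyRank c * copyGap h (T.dist · w) v) ≤ lastLabel k h T.diam f (T.dist · w) a b +
        (doubleStarTree k T w).dist (inCopy w c v) (hub k w false) := by
  rw [dist_inCopy_hub (by omega) hT, lastLabel]
  have hg : ∀ u, 1 ≤ copyGap h (T.dist · w) u := fun u => by
    have := hh u; simp only [copyGap]; omega
  have h0 := hh b
  have h0' := hh v
  have hr := copyRank_lt c
  rcases (hb v).eq_or_lt with he | hlt
  · obtain rfl := hinj he
    split_ifs with hs
    · have e1 := copyRank_false_lt c hs.symm
      have h5 := Nat.mul_le_mul_right (copyGap h (T.dist · w) v)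
        (show copyRank c + 1 ≤ 2 * k - 1 by omega)
      rw [Nat.succ_mul] at h5
      have := hg v
      omega
    · have h5 := Nat.mul_le_mul_right (copyGap h (T.dist · w) v)
        (show copyRank c ≤ 2 * k - 1 by omega)
      omega
  · have h1 := blockStart_lt (k := k) (h := h) (d := T.diam) (l := (T.dist · w)) hlt
    have h2 := hf.le_of_lt hlt
    have h3 := hT.dist_triangle (u := v) (v := w) (w := b)
    rw [T.dist_comm (u := w)] at h3
    have h4 := Nat.mul_le_mul (show 1 ≤ 2 * k - 1 by omega) (hg b)
    have h5 := Nat.mul_le_mul_right (copyGap h (T.dist · w) v)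
      (show copyRank c ≤ 2 * k - 1 by omega)
    omega

theorem starLabel_first_last (hk : 2 ≤ k) {h : ℕ} (hh : ∀ v, T.dist v w ≤ h) (f : V → ℕ)
    (a b : V) : 2 * h + 3 ≤ lastLabel k h T.diam f (T.dist · w) a b := by
  have h0 := hh a
  have h0' := hh b
  have h4 := Nat.mul_le_mul (show 1 ≤ 2 * k - 1 by omega)
    (show 1 ≤ copyGap h (T.dist · w) b by simp only [copyGap]; omega)
  rw [lastLabel]
  omega

theorem isRadioLabeling_starLabel (hk : 2 ≤ k) (hT : T.Connected) {h : ℕ}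
    (hh : ∀ v, T.dist v w ≤ h) (hD : (doubleStarTree k T w).diam = 2 * h + 3)
    (hd : T.diam ≤ 2 * h) {f : V → ℕ} (hf : IsRadioLabeling T f) (hinj : f.Injective) {a b : V}
    (ha : ∀ x, f a ≤ f x) (hb : ∀ x, f x ≤ f b) :
    IsRadioLabeling (doubleStarTree k T w)
      (starLabel k h T.diam w f (T.dist · w) a b) := by
  have key : ∀ (p q : AttachVertex (doubleStar k) w) (F : AttachVertex (doubleStar k) w → ℕ),
      (2 * h + 4 + F p ≤ F q + (doubleStarTree k T w).dist p q ∨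
        2 * h + 4 + F q ≤ F p + (doubleStarTree k T w).dist q p) →
      ((doubleStarTree k T w).diam : ℤ) + 1 - ((doubleStarTree k T w).dist p q : ℤ) ≤
        |(F p : ℤ) - (F q : ℤ)| := by
    intro p q F hpq
    rw [hD, le_abs]
    rw [SimpleGraph.dist_comm (u := q)] at hpq
    push_cast
    omega
  have h1 : starLabel k h T.diam w f (T.dist · w) a b (hub k w true) = 0 := rfl
  have h2 : starLabel k h T.diam w f (T.dist · w) a b (hub k w false) =
    lastLabel k h T.diam f (T.dist · w) a b := rfl
  have h3 : ∀ c v, starLabel k h T.diam w f (T.dist · w) a b (inCopy w c v) =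
    2 * h + 2 - T.dist a w + blockStart k h T.diam f (T.dist · w) v +
      copyRank c * copyGap h (T.dist · w) v := fun _ _ => rfl
  have hub_copy : ∀ b' c v,
      2 * h + 4 + starLabel k h T.diam w f (T.dist · w) a b (hub k w b') ≤
        starLabel k h T.diam w f (T.dist · w) a b (inCopy w c v) +
          (doubleStarTree k T w).dist (hub k w b') (inCopy w c v) ∨
      2 * h + 4 + starLabel k h T.diam w f (T.dist · w) a b (inCopy w c v) ≤
        starLabel k h T.diam w f (T.dist · w) a b (hub k w b') +
          (doubleStarTree k T w).dist (inCopy w c v) (hub k w b') := by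
    rintro (_ | _) c v
    · right
      rw [h2, h3]
      exact starLabel_last hk hT hh hd hf hinj a hb c v
    · left
      rw [h1, h3]
      exact starLabel_first hk hT hh hd hf hinj ha c v
  have copy_copy : ∀ c v c' v', f v < f v' →
      2 * h + 4 + starLabel k h T.diam w f (T.dist · w) a b (inCopy w c v) ≤
        starLabel k h T.diam w f (T.dist · w) a b (inCopy w c' v') +
          (doubleStarTree k T w).dist (inCopy w c v) (inCopy w c' v') := by
    intro c v c' v' hv
    have := starLabel_of_lt hk hT hh hd hf hv c c'
    rw [h3, h3]
    omega
  have copy_copy' : ∀ c c' v, copyRank c < copyRank c' →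
      2 * h + 4 + starLabel k h T.diam w f (T.dist · w) a b (inCopy w c v) ≤
        starLabel k h T.diam w f (T.dist · w) a b (inCopy w c' v) +
          (doubleStarTree k T w).dist (inCopy w c v) (inCopy w c' v) := by
    intro c c' v hc
    have := starLabel_of_copyRank_lt hk hT hh hc v
    rw [h3, h3]
    omega
  have hlast := starLabel_first_last (T := T) (w := w) hk hh f a b
  refine vertex_cases (by omega) (fun b₁ => vertex_cases (by omega) (fun b₂ hne => ?_)
    (fun c v _ => key _ _ _ (hub_copy b₁ c v))) (fun c v => vertex_cases (by omega)
    (fun b₁ _ => key _ _ _ (hub_copy b₁ c v).symm) (fun c' v' hne => key _ _ _ ?_))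
  · apply key
    rw [dist_hub_hub, dist_hub_hub]
    cases b₁ <;> cases b₂
    · exact absurd rfl hne
    · right; rw [h1, h2]; simp; omega
    · left; rw [h1, h2]; simp; omega
    · exact absurd rfl hne
  · rcases lt_trichotomy (f v) (f v') with hv | hv | hv
    · exact Or.inl (copy_copy _ _ _ _ hv)
    · obtain rfl := hinj hv
      have hc : copyRank c ≠ copyRank c' := fun hc => hne (by rw [copyRank_injective hc])
      exact hc.lt_or_gt.imp (copy_copy' _ _ _) (copy_copy' _ _ _)
    · exact Or.inr (copy_copy _ _ _ _ hv)

theorem starLabel_le_lastLabel (hk : 2 ≤ k) (hT : T.Connected) {h : ℕ}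
    (hh : ∀ v, T.dist v w ≤ h) (hd : T.diam ≤ 2 * h) {f : V → ℕ} (hf : IsRadioLabeling T f)
    (hinj : f.Injective) {a b : V} (hb : ∀ x, f x ≤ f b) (p : AttachVertex (doubleStar k) w) :
    starLabel k h T.diam w f (T.dist · w) a b p ≤ lastLabel k h T.diam f (T.dist · w) a b := by
  revert p
  refine vertex_cases (by omega) (fun b' => ?_) (fun c v => ?_)
  · cases b'
    · exact le_rfl
    · exact Nat.zero_le _
  · have h1 := starLabel_last hk hT hh hd hf hinj a hb c v
    have h2 := hh v
    rw [dist_inCopy_hub (by omega) hT] at h1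
    refine le_trans (le_of_eq (rfl : _ = 2 * h + 2 - T.dist a w +
      blockStart k h T.diam f (T.dist · w) v + copyRank c * copyGap h (T.dist · w) v)) ?_
    split_ifs at h1 <;> omega

end

/-! ### Lower bound trees -/

theorem nontrivial_of_lb {V : Type*} [Fintype V] {T : SimpleGraph V} (hT : IsLowerBoundTree T)
    {w : V} (hw : weightCenters T = {w}) : Nontrivial V := by
  by_contra hn
  rw [not_nontrivial_iff_subsingleton] at hn
  have h1 := hT.2
  rw [lb_of_weightCenters_eq_singleton hw] at h1
  have h2 : Fintype.card V = 1 := Fintype.card_eq_one_iff.2 ⟨w, fun _ => Subsingleton.elim _ _⟩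
  have h3 : ∀ v, T.dist v w = 0 := fun v => by rw [Subsingleton.elim v w, SimpleGraph.dist_self]
  have h4 : radioNumber T ≤ 0 := Nat.sInf_le ⟨fun _ => 0, fun u v huv =>
    absurd (Subsingleton.elim u v) huv, ⟨w, rfl⟩, by rintro _ ⟨x, rfl⟩; exact le_rfl⟩
  simp [h2, h3] at h1
  omega

theorem radioNumber_doubleStarTree {V : Type*} [Fintype V] {T : SimpleGraph V} {w : V}
    (hT : IsLowerBoundTree T) (hw : weightCenters T = {w}) {k : ℕ} (hk : 2 ≤ k) :
    (radioNumber (doubleStarTree k T w) : ℤ) = lb (doubleStarTree k T w) := by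
  have hc := hT.1.connected
  have hk1 : 1 ≤ k := by omega
  have : Nonempty V := ⟨w⟩
  obtain ⟨x, hx⟩ := Finite.exists_max (T.dist · w)
  set h := T.dist x w
  have hD : (doubleStarTree k T w).diam = 2 * h + 3 := diam_doubleStarTree hk1 hc hx ⟨x, rfl⟩
  have hd : T.diam ≤ 2 * h := by
    obtain ⟨u, v, huv⟩ := T.exists_dist_eq_diam
    have h1 := hc.dist_triangle (u := u) (v := w) (w := v)
    rw [T.dist_comm (u := w)] at h1
    have h2 := hx u
    have h3 := hx v
    omega
  obtain ⟨f, hf, ⟨b, hfb⟩, hmax⟩ := Nat.sInf_mem (exists_isRadioLabeling T)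
  change f b = radioNumber T at hfb
  have hb : ∀ y, f y ≤ f b := fun y => by rw [hfb]; exact hmax ⟨y, rfl⟩
  obtain ⟨a, ha⟩ := Finite.exists_min f
  have hinj := hf.injective (SimpleGraph.connected_iff_ediam_ne_top.1 hc)
  -- The first and the last vertex differ, so that they are not both the weight center.
  have hab : 1 ≤ T.dist a w + T.dist b w := by
    have := nontrivial_of_lb hT hw
    by_contra! h0
    have h1 := hc.dist_eq_zero_iff.1 (show T.dist a w = 0 by omega)
    have h2 := hc.dist_eq_zero_iff.1 (show T.dist b w = 0 by omega)
    obtain ⟨y, hy⟩ := exists_ne w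
    have h3 := ha y
    have h4 := hb y
    rw [h1] at h3
    rw [h2] at h4
    exact hy (hinj (le_antisymm h4 h3))
  have hrad := isRadioLabeling_starLabel hk hc hx hD hd hf hinj ha hb
  have hgr : IsGreatest (Set.range (starLabel k h T.diam w f (T.dist · w) a b))
      (lastLabel k h T.diam f (T.dist · w) a b) :=
    ⟨⟨hub k w false, rfl⟩, by
      rintro _ ⟨p, rfl⟩
      exact starLabel_le_lastLabel hk hc hx hd hf hinj hb p⟩
  apply le_antisymm
  · rw [lb_doubleStarTree hk1 hc, hD]
    have hle : radioNumber (doubleStarTree k T w) ≤ lastLabel k h T.diam f (T.dist · w) a b :=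
      Nat.sInf_le ⟨_, hrad, hgr⟩
    have h1 := blockStart_of_isMax (k := k) (h := h) (d := T.diam) (l := (T.dist · w)) hinj hb
    have h2 : (∑ u, copyGap h (T.dist · w) u : ℤ) =
        Fintype.card V * (2 * h + 1) - 2 * ∑ u, (T.dist u w : ℤ) := by
      have : ∀ u, (copyGap h (T.dist · w) u : ℤ) = 2 * h + 1 - 2 * T.dist u w := fun u => by
        have := hx u
        simp only [copyGap]
        omega
      simp only [this, Finset.sum_sub_distrib, Finset.mul_sum, Finset.sum_const, Finset.card_univ,
        nsmul_eq_mul]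
    have h3 := hT.2
    rw [lb_of_weightCenters_eq_singleton hw, ← hfb] at h3
    have ha' := hx a
    have hb' := hx b
    have h4 : (lastLabel k h T.diam f (T.dist · w) a b : ℤ) =
        (2 * h + 2 - T.dist a w) + (blockStart k h T.diam f (T.dist · w) b +
          ((2 * k - 1 : ℕ) : ℤ) * copyGap h (T.dist · w) b) + (2 * h + 2 - T.dist b w) := by
      rw [lastLabel]
      push_cast [show T.dist a w ≤ 2 * h + 2 by omega, show T.dist b w ≤ 2 * h + 2 by omega]
      ring
    zify at h1
    rw [h2, h3] at h1
    push_cast [hd, show 1 ≤ 2 * k by omega] at h1 h4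
    zify at hle hab
    push_cast
    linarith
  · have hne : Nonempty (AttachVertex (doubleStar k) w) := ⟨hub k w false⟩
    obtain ⟨g, hg, hgm⟩ := Nat.sInf_mem (exists_isRadioLabeling (doubleStarTree k T w))
    have h1 := span_ge_of_dist_le (dist_le_level_add_level hk1 hc) hg hgm
    rw [lb, epsilon_doubleStarTree hk1 hc, totalLevel]
    push_cast
    rw [add_zero, add_zero]
    exact h1

end RadioTree

theorem theorem3p3 {V : Type*} [Fintype V] (T : SimpleGraph V) (w₀ : V)
    (hT : RadioTree.IsLowerBoundTree T) (hw : RadioTree.weightCenters T = {w₀})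
    (k : ℕ) (hk : 2 ≤ k) :
    RadioTree.weightCenters (RadioTree.doubleStarTree k T w₀) =
        {RadioTree.hub k w₀ false, RadioTree.hub k w₀ true} ∧
      RadioTree.IsLowerBoundTree (RadioTree.doubleStarTree k T w₀) ∧
      (RadioTree.radioNumber (RadioTree.doubleStarTree k T w₀) : ℤ) =
        2 * (k : ℤ) * ((RadioTree.radioNumber T : ℤ)
          + (Fintype.card V : ℤ) *
            (((RadioTree.doubleStarTree k T w₀).diam : ℤ) - (T.diam : ℤ) - 3)
          + (T.diam : ℤ))
        + ((RadioTree.doubleStarTree k T w₀).diam : ℤ) := by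
  have hk1 : 1 ≤ k := by omega
  have hrn := RadioTree.radioNumber_doubleStarTree hT hw hk
  refine ⟨RadioTree.weightCenters_doubleStarTree hk1 hT.1.connected,
    ⟨RadioTree.isTree_doubleStarTree hk1 hT.1, hrn⟩, ?_⟩
  rw [hrn, RadioTree.lb_doubleStarTree hk1 hT.1.connected, hT.2,
    RadioTree.lb_of_weightCenters_eq_singleton hw]
  ring
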